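/- Let the state $\omega\in\Omega=[0,1]$ have a distribution $F$ with a density $f\ge 0$, and let the type $\theta\in\Theta=\{1,\dots,n\}$ be independent of $\omega$ with $\Pr[\theta]=g(\theta)>0$, $\sum_\theta g(\theta)=1$. Let $A$ be a nonempty compact space of actions, and let the receiver's utility $u$ and the designer's utility $v$ on $A\times\Omega\times\Theta$ be of the form $u(a,\omega,\theta)=u_1(a,\theta)\,\omega+u_2(a,\theta)$ and $v(a,\omega,\theta)=v_1(a,\theta)\,\omega+v_2(a,\theta)$ with $u_1,u_2,v_1,v_2$ continuous in $a$. A signal $\mu$ is a Markov kernel $\mu(\cdot\mid\omega)$ from $\Omega$ to a measurable space $S$ of messages; $\mathbb E_\mu[\,\cdot\mid s]$ denotes expectation under the posterior distribution of the state given the message $s$. A mechanism $M$ is a set of signals. A strategy of the receiver in $M$ consists of signals $\mu^\theta\in M$ and actions $a^\theta(s)$, such that $s\mapsto\mathbb E_{\mu^\theta}[v(a^\theta(s),\omega,\theta)\mid s]$ is integrable; it is optimal in $M$ if, for every $\theta$, $a^\theta(s)\in\arg\max_{b\in A}\mathbb E_{\mu^\theta}[u(b,\omega,\theta)\mid s]$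 for almost every message $s$ of $\mu^\theta$, and $$\mu^\theta\in\arg\max_{\nu\in M}\int_\Omega\int_S\max_{b\in A}\mathbb E_\nu[u(b,\omega,\theta)\mid s]\,d\nu(s\mid\omega)\,dF(\omega).$$ The designer's payoff is then $$\sum_{\theta\in\Theta}g(\theta)\int_\Omega\int_S\mathbb E_{\mu^\theta}[v(a^\theta(s),\omega,\theta)\mid s]\,d\mu^\theta(s\mid\omega)\,dF(\omega).$$ Put $\bar u(m,\theta)=\max_{a\in A}u(a,m,\theta)$, $A(m,\theta)=\arg\max_{b\in A}u(b,m,\theta)$ and $\bar v(m,\theta)=\max_{a\in A(m,\theta)}v(a,m,\theta)$. A direct mechanism is a tuple $(\mu^1,\dots,\mu^n)$ of signals; let $G_\theta(x)=\Pr[\mathbb E_{\mu^\theta}[\omega\mid s]\le x]$ be the distribution of the posterior mean induced by $\mu^\theta$. It is incentive compatible if $\int_\Omega\bar u(s,\theta)\,dG_\theta(s)\ge\int_\Omega\bar u(s,\theta)\,dG_{\theta'}(s)$ for all $\theta,\theta'\in\Theta$. It maximizes the designer's payoff if there are actions $a$ such that the strategy in which each type $\theta$ chooses $\mu^\theta$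 and acts according to $a^\theta$ is optimal for the receiver in $\{\mu^1,\dots,\mu^n\}$ and gives the designer at least the payoff of any mechanism $M$ with any optimal strategy of the receiver in $M$. Then the direct mechanism $(\mu^1,\dots,\mu^n)$ is incentive compatible and maximizes the designer's payoff if and only if the induced $(G_1,\dots,G_n)$ solves $$\max_{H_1,\dots,H_n}\ \sum_{\theta\in\Theta}g(\theta)\int_\Omega\bar v(s,\theta)\,dH_\theta(s)$$ over all tuples of probability distributions on $[0,1]$ such that $$\int_0^1\bar u(s,\theta)\,dH_\theta(s)\ \ge\ \int_0^1\bar u(s,\theta)\,dH_{\theta'}(s)\qquad\forall\,\theta,\theta'\in\Theta,$$ and every $H_\theta$ is a mean-preserving contraction of $F$, that is, in terms of cumulative distribution functions, $\int_x^1H_\theta(z)\,dz\ge\int_x^1F(z)\,dz$ for all $x\in[0,1]$, with equality for $x=0$. -/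

import Mathlib

open MeasureTheory ProbabilityTheory

universe u w

noncomputable section

namespace InfoDesign

/-- The state space `Ω = [0, 1]`. -/
abbrev State : Type := unitInterval

/-! ### Signals (Blackwell experiments) -/

/-- A signal: a measurable space `S` of messages and, for every state `ω`, a conditional
distribution `μ(· | ω)` on `S`, measurable in `ω`. -/
structure Signal : Type (u + 1) where
  /-- the set of signal realizations (messages) -/
  S : Type u
  [measurableSpace : MeasurableSpace S]
  /-- the conditional distributions `μ(· | ω)` -/
  kernel : Kernel State S
  [isMarkov : IsMarkovKernel kernel]

attribute [instance] Signal.measurableSpace Signal.isMarkov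

variable (F : Measure State) [IsProbabilityMeasure F]

/-- The unconditional distribution of the message of the signal `μ`. -/
def Signal.messageLaw (μ : Signal.{u}) : Measure μ.S := F.bind μ.kernel

/-- The posterior distribution of the state given the message `s`: a regular conditional
probability of the state given the message (unique up to null sets of messages). -/
def Signal.posterior (μ : Signal.{u}) : Kernel μ.S State := ProbabilityTheory.posterior μ.kernel F

instance (μ : Signal.{u}) : IsMarkovKernel (μ.posterior F) := by
  unfold Signal.posterior; infer_instance

instance (μ : Signal.{u}) : IsProbabilityMeasure (μ.messageLaw F) := by
  unfold Signal.messageLaw; infer_instance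

/-- The mean of a distribution on `[0, 1]` lies in `[0, 1]`. -/
theorem mean_mem (P : Measure State) [IsProbabilityMeasure P] :
    (∫ ω, (ω : ℝ) ∂P) ∈ Set.Icc (0 : ℝ) 1 := by
  refine ⟨integral_nonneg fun ω => ω.2.1, ?_⟩
  have h : Integrable (fun ω : State => (ω : ℝ)) P :=
    Integrable.of_bound (by fun_prop) 1
      (Filter.Eventually.of_forall fun ω => by
        rw [Real.norm_eq_abs, abs_of_nonneg ω.2.1]; exact ω.2.2)
  calc (∫ ω, (ω : ℝ) ∂P) ≤ ∫ _, (1 : ℝ) ∂P :=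
        integral_mono h (integrable_const _) fun ω => ω.2.2
    _ = 1 := by simp

/-- The posterior mean `E_μ[ω | s]`, a point of `[0, 1]`. -/
def Signal.posteriorMean (μ : Signal.{u}) (s : μ.S) : State :=
  ⟨∫ ω, (ω : ℝ) ∂(μ.posterior F s), mean_mem _⟩

theorem Signal.measurable_posteriorMean (μ : Signal.{u}) : Measurable (μ.posteriorMean F) := by
  refine Measurable.subtype_mk ?_
  have h : StronglyMeasurable fun ω : State => (ω : ℝ) :=
    (measurable_subtype_coe).stronglyMeasurable
  exact (h.integral_kernel (κ := μ.posterior F)).measurable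

/-- The distribution `G` of the posterior mean induced by the signal `μ`, i.e. the distribution
with CDF `G(x) = Pr[E_μ[ω | s] ≤ x]`. -/
def Signal.meanLaw (μ : Signal.{u}) : ProbabilityMeasure State :=
  ⟨(μ.messageLaw F).map (μ.posteriorMean F),
    Measure.isProbabilityMeasure_map (μ.measurable_posteriorMean F).aemeasurable⟩

/-! ### Mean-preserving contractions -/

/-- The cumulative distribution function of a distribution on `[0, 1]`. -/
def cdfState (H : Measure State) (z : ℝ) : ℝ := H.real {ω : State | (ω : ℝ) ≤ z}

/-- `H` is a mean-preserving contraction of `H'` (written `H' ⪯ H`). -/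
def IsMPC (H' H : Measure State) : Prop :=
  (∀ ω : State, ∫ z in (ω : ℝ)..1, cdfState H z ≥ ∫ z in (ω : ℝ)..1, cdfState H' z) ∧
    ∫ z in (0 : ℝ)..1, cdfState H z = ∫ z in (0 : ℝ)..1, cdfState H' z

/-! ### Utilities -/

variable {A : Type w} {n : ℕ}

/-- Quasi-linearity in the state, with coefficients continuous in the action. -/
def QuasiLinear [TopologicalSpace A] (U : A → State → Fin n → ℝ) : Prop :=
  ∃ U₁ U₂ : A → Fin n → ℝ, (∀ θ, Continuous fun a => U₁ a θ) ∧ (∀ θ, Continuous fun a => U₂ a θ) ∧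
    ∀ a ω θ, U a ω θ = U₁ a θ * (ω : ℝ) + U₂ a θ

/-- The receiver's indirect utility `ū(m, θ) = max_{a ∈ A} u(a, m, θ)`. -/
def receiverIndirect (u : A → State → Fin n → ℝ) (m : State) (θ : Fin n) : ℝ := ⨆ a, u a m θ

/-- The set of optimal actions `A(m, θ) = argmax_{b ∈ A} u(b, m, θ)`. -/
def optimalActions (u : A → State → Fin n → ℝ) (m : State) (θ : Fin n) : Set A :=
  {a | ∀ b, u b m θ ≤ u a m θ}

/-- The designer's indirect utility `v̄(m, θ) = max_{a ∈ A(m, θ)} v(a, m, θ)`. -/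
def designerIndirect (u v : A → State → Fin n → ℝ) (m : State) (θ : Fin n) : ℝ :=
  sSup ((fun a => v a m θ) '' optimalActions u m θ)

/-! ### Mechanisms and strategies -/

/-- The conditional expectation `E_μ[U(b, ω, θ) | s]`, given the message `s` of `μ`. -/
def Signal.condExpUtility (U : A → State → Fin n → ℝ) (μ : Signal.{u}) (s : μ.S) (b : A)
    (θ : Fin n) : ℝ :=
  ∫ ω, U b ω θ ∂(μ.posterior F s)

/-- The expected utility of type `θ` from observing the signal `ν` and then acting optimally. -/
def Signal.receiverValue (u : A → State → Fin n → ℝ) (ν : Signal.{u}) (θ : Fin n) : ℝ :=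
  ∫ ω, ∫ s, (⨆ b, ν.condExpUtility F u s b θ) ∂(ν.kernel ω) ∂F

/-- A strategy of the receiver: the signal `μ^θ` chosen by type `θ` and the action `a^θ(s)` that
type `θ` takes after the message `s`. -/
structure Strategy (A : Type w) (n : ℕ) where
  /-- the chosen signals -/
  signal : Fin n → Signal.{u}
  /-- the chosen actions -/
  action : (θ : Fin n) → (signal θ).S → A

/-- `σ` is an optimal strategy of the receiver in the mechanism (menu of signals) `M`. -/
structure Strategy.IsOptimal (u : A → State → Fin n → ℝ) (M : Set Signal.{u})
    (σ : Strategy.{u} A n) : Prop where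
  /-- every type chooses a signal of the menu -/
  mem : ∀ θ, σ.signal θ ∈ M
  /-- actions are optimal after almost every message -/
  optAct : ∀ θ, ∀ᵐ s ∂((σ.signal θ).messageLaw F), ∀ b,
    (σ.signal θ).condExpUtility F u s b θ ≤ (σ.signal θ).condExpUtility F u s (σ.action θ s) θ
  /-- every type chooses a signal that is best for him in the menu -/
  optSignal : ∀ θ, ∀ ν ∈ M, ν.receiverValue F u θ ≤ (σ.signal θ).receiverValue F u θ

/-- The designer's expected utility under `σ` exists: for every type, her conditional expected
utility given the message is integrable. This is the only measurability asked of the actions. -/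
def Strategy.HasPayoff (v : A → State → Fin n → ℝ) (σ : Strategy.{u} A n) : Prop :=
  ∀ θ, Integrable (fun s => (σ.signal θ).condExpUtility F v s (σ.action θ s) θ)
    ((σ.signal θ).messageLaw F)

/-- The designer's expected utility under the strategy `σ` of the receiver. -/
def Strategy.designerPayoff (g : Fin n → ℝ) (v : A → State → Fin n → ℝ)
    (σ : Strategy.{u} A n) : ℝ :=
  ∑ θ, g θ * ∫ ω, ∫ s, (σ.signal θ).condExpUtility F v s (σ.action θ s) θ
    ∂((σ.signal θ).kernel ω) ∂F

/-- Incentive compatibility of the direct mechanism `(μ^1, …, μ^n)`. -/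
def IncentiveCompatible (u : A → State → Fin n → ℝ) (μ : Fin n → Signal.{u}) : Prop :=
  ∀ θ θ', ∫ s, receiverIndirect u s θ ∂((μ θ).meanLaw F : Measure State) ≥
    ∫ s, receiverIndirect u s θ ∂((μ θ').meanLaw F : Measure State)

/-- The direct mechanism `(μ^1, …, μ^n)` maximizes the designer's payoff: together with some
optimal strategy of the receiver in which every type `θ` chooses `μ^θ`, it gives the designer at
least as much as every mechanism `M` with every optimal strategy of the receiver in `M`. -/
def DesignerOptimal (g : Fin n → ℝ) (u v : A → State → Fin n → ℝ)
    (μ : Fin n → Signal.{u}) : Prop :=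
  ∃ a : (θ : Fin n) → (μ θ).S → A,
    (Strategy.mk μ a).IsOptimal F u (Set.range μ) ∧ (Strategy.mk μ a).HasPayoff F v ∧
    ∀ (M : Set Signal.{u}) (σ : Strategy.{u} A n), σ.IsOptimal F u M → σ.HasPayoff F v →
      σ.designerPayoff F g v ≤ (Strategy.mk μ a).designerPayoff F g v

/-! ### The program over posterior-mean distributions -/

/-- The constraints of the program. -/
structure ProgramFeasible (u : A → State → Fin n → ℝ)
    (G : Fin n → ProbabilityMeasure State) : Prop where
  /-- the incentive constraints -/
  ic : ∀ θ θ', ∫ s, receiverIndirect u s θ ∂(G θ : Measure State) ≥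
    ∫ s, receiverIndirect u s θ ∂(G θ' : Measure State)
  /-- every `G θ` is a mean-preserving contraction of `F` -/
  mpc : ∀ θ, IsMPC F (G θ : Measure State)

/-- The objective of the program. -/
def programObjective (g : Fin n → ℝ) (u v : A → State → Fin n → ℝ)
    (G : Fin n → ProbabilityMeasure State) : ℝ :=
  ∑ θ, g θ * ∫ s, designerIndirect u v s θ ∂(G θ : Measure State)

/-- `(G_1, …, G_n)` solves the program. -/
def SolvesProgram (g : Fin n → ℝ) (u v : A → State → Fin n → ℝ)
    (G : Fin n → ProbabilityMeasure State) : Prop :=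
  ProgramFeasible F u G ∧
    ∀ H : Fin n → ProbabilityMeasure State, ProgramFeasible F u H →
      programObjective g u v H ≤ programObjective g u v G

end InfoDesign

end

/-! Because utilities are affine in the state, the posterior after a message matters only through
its mean (`condExpUtility_eq`). A type's value of a signal is therefore the integral of `ū` against
the law of the posterior mean. The designer gets at most the integral of `v̄` from any optimal
strategy (`Strategy.designerPayoff_le`), and exactly that when ties are broken in her favour
(`IncentiveCompatible.exists_action`). In any menu each type could have imitated another type's
choice, so the chosen signals satisfy the incentive constraints; conversely, incentive compatible
signals form a menu in which choosing one's own is optimal.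

It remains to identify the laws of posterior means with the mean-preserving contractions of `F`. One
inclusion is Jensen's inequality (`Signal.isMPC_meanLaw`). The other is Strassen's theorem: the CDF
inequalities give the concave order, duality turns that order into a martingale coupling of `F` and
`H`, and conditioning the coupling on the state produces a signal whose message is its own posterior
mean (`IsMPC.exists_signal`). -/

noncomputable section

namespace InfoDesign

/-! ### Signals and posterior means -/

section Signals

theorem integral_bind_kernel {α β : Type*} [MeasurableSpace α] [MeasurableSpace β]
    {P : Measure α} {κ : Kernel α β} {φ : β → ℝ} (hφ : Integrable φ (P.bind κ)) :
    ∫ y, φ y ∂(P.bind κ) = ∫ x, ∫ y, φ y ∂(κ x) ∂P := by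
  rw [Measure.comp_eq_comp_const_apply] at hφ ⊢
  rw [Kernel.integral_comp hφ, Kernel.const_apply]

theorem Signal.integral_messageLaw {F : Measure State} (μ : Signal.{u}) {φ : μ.S → ℝ}
    (hφ : Integrable φ (μ.messageLaw F)) :
    ∫ ω, ∫ s, φ s ∂(μ.kernel ω) ∂F = ∫ s, φ s ∂(μ.messageLaw F) := by
  exact (integral_bind_kernel hφ).symm

variable {F : Measure State} [IsProbabilityMeasure F] {A : Type w} [TopologicalSpace A] {n : ℕ}

theorem integrable_of_continuous (P : Measure State) [IsFiniteMeasure P] {φ : State → ℝ}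
    (hφ : Continuous φ) : Integrable φ P :=
  hφ.integrable_of_hasCompactSupport (HasCompactSupport.of_compactSpace φ)

theorem integrable_coe (P : Measure State) [IsFiniteMeasure P] :
    Integrable (fun ω : State => (ω : ℝ)) P :=
  integrable_of_continuous P continuous_subtype_val

/-- Expectation commutes with affine functions of the state. -/
theorem condExpUtility_eq {U : A → State → Fin n → ℝ} (hU : QuasiLinear U) (μ : Signal.{u})
    (s : μ.S) (b : A) (θ : Fin n) :
    μ.condExpUtility F U s b θ = U b (μ.posteriorMean F s) θ := by
  obtain ⟨U₁, U₂, -, -, h⟩ := hU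
  simp only [Signal.condExpUtility, h]
  rw [integral_add ((integrable_coe _).const_mul _) (integrable_const _), integral_const_mul]
  simp [Signal.posteriorMean]

theorem Signal.integral_meanLaw (μ : Signal.{u}) {φ : State → ℝ} (hφ : Measurable φ) :
    ∫ m, φ m ∂(μ.meanLaw F : Measure State) = ∫ s, φ (μ.posteriorMean F s) ∂(μ.messageLaw F) := by
  exact integral_map (μ.measurable_posteriorMean F).aemeasurable hφ.aestronglyMeasurable

end Signals

/-! ### Regularity of the indirect utilities -/

section Indirect

variable {A : Type w} [TopologicalSpace A] {n : ℕ} {u v : A → State → Fin n → ℝ}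

theorem QuasiLinear.continuous {U : A → State → Fin n → ℝ} (hU : QuasiLinear U) (θ : Fin n) :
    Continuous fun p : A × State => U p.1 p.2 θ := by
  obtain ⟨U₁, U₂, h₁, h₂, h⟩ := hU
  simp only [h]
  exact ((((h₁ θ).comp continuous_fst).mul (continuous_subtype_val.comp continuous_snd))).add
    ((h₂ θ).comp continuous_fst)

variable [CompactSpace A]

theorem QuasiLinear.exists_bound {U : A → State → Fin n → ℝ} (hU : QuasiLinear U) (θ : Fin n) :
    ∃ C, ∀ a m, |U a m θ| ≤ C := by
  obtain ⟨C, hC⟩ := isCompact_univ.exists_bound_of_continuousOn (hU.continuous θ).continuousOn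
  exact ⟨C, fun a m => hC (a, m) trivial⟩

theorem continuous_receiverIndirect (hu : QuasiLinear u) (θ : Fin n) :
    Continuous fun m => receiverIndirect u m θ := by
  have h := isCompact_univ.continuous_sSup (f := fun (m : State) (a : A) => u a m θ)
    (K := Set.univ) ((hu.continuous θ).comp continuous_swap)
  simpa only [Set.image_univ, receiverIndirect, sSup_range] using h

theorem isCompact_optimalActions (hu : QuasiLinear u) (m : State) (θ : Fin n) :
    IsCompact (optimalActions u m θ) := by
  refine IsClosed.isCompact ?_
  simp only [optimalActions, Set.ofPred_forall]
  exact isClosed_iInter fun b => isClosed_le continuous_const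
    ((hu.continuous θ).comp (Continuous.prodMk_left m))

theorem bddAbove_image_optimalActions (hv : QuasiLinear v) (m : State) (θ : Fin n) :
    BddAbove ((fun a => v a m θ) '' optimalActions u m θ) := by
  obtain ⟨C, hC⟩ := hv.exists_bound θ
  refine ⟨C, ?_⟩
  rintro _ ⟨a, -, rfl⟩
  exact (le_abs_self _).trans (hC a m)

theorem le_designerIndirect (hv : QuasiLinear v) {m : State} {θ : Fin n} {a : A}
    (ha : a ∈ optimalActions u m θ) : v a m θ ≤ designerIndirect u v m θ :=
  le_csSup (bddAbove_image_optimalActions hv m θ) ⟨a, ha, rfl⟩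

variable [Nonempty A]

theorem nonempty_optimalActions (hu : QuasiLinear u) (m : State) (θ : Fin n) :
    (optimalActions u m θ).Nonempty := by
  obtain ⟨a, -, ha⟩ := isCompact_univ.exists_isMaxOn Set.univ_nonempty
    ((hu.continuous θ).comp (Continuous.prodMk_left m)).continuousOn
  exact ⟨a, fun b => ha (Set.mem_univ b)⟩

theorem exists_eq_designerIndirect (hu : QuasiLinear u) (hv : QuasiLinear v) (m : State)
    (θ : Fin n) : ∃ a ∈ optimalActions u m θ, v a m θ = designerIndirect u v m θ := by
  obtain ⟨a, ha, h⟩ := (isCompact_optimalActions hu m θ).exists_sSup_image_eq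
    (nonempty_optimalActions hu m θ)
    ((hv.continuous θ).comp (Continuous.prodMk_left m)).continuousOn
  exact ⟨a, ha, h.symm⟩

/-- `v̄` is upper semicontinuous: the maximum is attained, so a superlevel set is the projection
along the compact `A` of a closed set, hence closed. -/
theorem measurable_designerIndirect (hu : QuasiLinear u) (hv : QuasiLinear v) (θ : Fin n) :
    Measurable fun m => designerIndirect u v m θ := by
  refine measurable_of_Ici fun c => IsClosed.measurableSet ?_
  have h : (fun m => designerIndirect u v m θ) ⁻¹' Set.Ici c =
      Prod.snd '' {p : A × State | (∀ b, u b p.2 θ ≤ u p.1 p.2 θ) ∧ c ≤ v p.1 p.2 θ} := by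
    ext m
    constructor
    · intro hm
      obtain ⟨a, ha, h⟩ := exists_eq_designerIndirect hu hv m θ
      exact ⟨(a, m), ⟨ha, h ▸ hm⟩, rfl⟩
    · rintro ⟨⟨a, m⟩, ⟨ha, hc⟩, rfl⟩
      exact hc.trans (le_designerIndirect hv ha)
  rw [h]
  refine isClosedMap_snd_of_compactSpace _ (IsClosed.and ?_ ?_)
  · simp only [Set.ofPred_forall]
    exact isClosed_iInter fun b => isClosed_le
      ((hu.continuous θ).comp (continuous_const.prodMk continuous_snd)) (hu.continuous θ)
  · exact isClosed_le continuous_const (hv.continuous θ)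

theorem integrable_designerIndirect (hu : QuasiLinear u) (hv : QuasiLinear v) (θ : Fin n)
    (P : Measure State) [IsFiniteMeasure P] :
    Integrable (fun m => designerIndirect u v m θ) P := by
  obtain ⟨C, hC⟩ := hv.exists_bound θ
  refine Integrable.of_bound (measurable_designerIndirect hu hv θ).aestronglyMeasurable C
    (Filter.Eventually.of_forall fun m => ?_)
  obtain ⟨a, -, h⟩ := exists_eq_designerIndirect hu hv m θ
  exact h ▸ hC a m

end Indirect

/-! ### Payoffs in terms of posterior-mean laws -/

section Values

variable {F : Measure State} [IsProbabilityMeasure F] {A : Type w} [TopologicalSpace A]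
  [CompactSpace A] {n : ℕ} {u v : A → State → Fin n → ℝ}

theorem Signal.receiverValue_eq (hu : QuasiLinear u) (ν : Signal.{u}) (θ : Fin n) :
    ν.receiverValue F u θ = ∫ m, receiverIndirect u m θ ∂(ν.meanLaw F : Measure State) := by
  have hc := continuous_receiverIndirect hu θ
  rw [ν.integral_meanLaw hc.measurable, Signal.receiverValue]
  simp only [condExpUtility_eq hu]
  exact ν.integral_messageLaw ((integrable_of_continuous _ hc).comp_measurable
    (μ := ν.messageLaw F) (ν.measurable_posteriorMean F))

/-- Revelation principle: the menu also contains the signals chosen by the other types. -/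
theorem Strategy.IsOptimal.programFeasible_ic (hu : QuasiLinear u) {M : Set Signal.{u}}
    {σ : Strategy.{u} A n} (hσ : σ.IsOptimal F u M) (θ θ' : Fin n) :
    ∫ m, receiverIndirect u m θ ∂((σ.signal θ).meanLaw F : Measure State) ≥
      ∫ m, receiverIndirect u m θ ∂((σ.signal θ').meanLaw F : Measure State) := by
  simpa only [Signal.receiverValue_eq hu] using hσ.optSignal θ _ (hσ.mem θ')

variable [Nonempty A]

theorem Strategy.designerPayoff_le {g : Fin n → ℝ} (hg : ∀ θ, 0 < g θ) (hu : QuasiLinear u)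
    (hv : QuasiLinear v) {M : Set Signal.{u}} {σ : Strategy.{u} A n} (hσ : σ.IsOptimal F u M)
    (hp : σ.HasPayoff F v) :
    σ.designerPayoff F g v ≤ programObjective g u v fun θ => (σ.signal θ).meanLaw F := by
  refine Finset.sum_le_sum fun θ _ => mul_le_mul_of_nonneg_left ?_ (hg θ).le
  rw [(σ.signal θ).integral_messageLaw (hp θ),
    (σ.signal θ).integral_meanLaw (measurable_designerIndirect hu hv θ)]
  refine integral_mono_ae (hp θ) ((integrable_designerIndirect hu hv θ _).comp_measurable
    ((σ.signal θ).measurable_posteriorMean F)) ?_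
  filter_upwards [hσ.optAct θ] with s hs
  simp only [condExpUtility_eq hu] at hs
  rw [condExpUtility_eq hv]
  exact le_designerIndirect hv hs

/-- Breaking ties in favour of the designer is optimal for the receiver in an incentive compatible
direct mechanism and gives the designer the objective of the program. -/
theorem IncentiveCompatible.exists_action {g : Fin n → ℝ} (hu : QuasiLinear u)
    (hv : QuasiLinear v) {μ : Fin n → Signal.{u}} (hμ : IncentiveCompatible F u μ) :
    ∃ a : (θ : Fin n) → (μ θ).S → A,
      (Strategy.mk μ a).IsOptimal F u (Set.range μ) ∧ (Strategy.mk μ a).HasPayoff F v ∧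
      (Strategy.mk μ a).designerPayoff F g v =
        programObjective g u v fun θ => (μ θ).meanLaw F := by
  -- The selection need not be measurable: payoffs see it only through `v̄` at the posterior mean,
  -- which is measurable.
  choose a ha hav using fun θ m => exists_eq_designerIndirect hu hv m θ
  have hp : (Strategy.mk μ fun θ s => a θ ((μ θ).posteriorMean F s)).HasPayoff F v := by
    intro θ
    simp only [condExpUtility_eq hv, hav]
    exact (integrable_designerIndirect hu hv θ _).comp_measurable
      ((μ θ).measurable_posteriorMean F)
  refine ⟨_, ⟨fun θ => ⟨θ, rfl⟩, fun θ => Filter.Eventually.of_forall fun s b => ?_, ?_⟩, hp, ?_⟩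
  · simp only [condExpUtility_eq hu]
    exact ha θ _ b
  · rintro θ _ ⟨θ', rfl⟩
    simp only [Signal.receiverValue_eq hu]
    exact hμ θ θ'
  · refine Finset.sum_congr rfl fun θ _ => ?_
    rw [(μ θ).integral_messageLaw (hp θ),
      (μ θ).integral_meanLaw (measurable_designerIndirect hu hv θ)]
    simp only [condExpUtility_eq hv, hav]

end Values

/-! ### Mean-preserving contractions; Jensen's inequality -/

section MeanPreservingContraction

/-- Fubini: for fixed `ω`, the indicator of `ω ≤ z` integrates over `z` in `(x, 1]` to `1 - max ω
x`. -/
theorem integral_cdfState (H : Measure State) [IsProbabilityMeasure H] (x : State) :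
    ∫ z in (x : ℝ)..1, cdfState H z = 1 - ∫ ω : State, max (ω : ℝ) x ∂H := by
  have hm : Measurable fun p : ℝ × State => if (p.2 : ℝ) ≤ p.1 then (1 : ℝ) else 0 :=
    Measurable.ite (measurableSet_le (by fun_prop) (by fun_prop)) measurable_const measurable_const
  have hcdf (z : ℝ) : cdfState H z = ∫ ω : State, (if (ω : ℝ) ≤ z then (1 : ℝ) else 0) ∂H := by
    have := integral_indicator_one (μ := H) (s := {ω : State | (ω : ℝ) ≤ z})
      (measurableSet_le (by fun_prop) (by fun_prop))
    rw [cdfState, ← this]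
    rfl
  have hinner (ω : State) :
      ∫ z in Set.Ioc (x : ℝ) 1, (if (ω : ℝ) ≤ z then (1 : ℝ) else 0) = 1 - max (ω : ℝ) x := by
    have h1 : ∀ z : ℝ, (if (ω : ℝ) ≤ z then (1 : ℝ) else 0) = (Set.Ici (ω : ℝ)).indicator 1 z :=
      fun z => rfl
    simp only [h1]
    rw [integral_indicator_one measurableSet_Ici, measureReal_restrict_apply measurableSet_Ici]
    rcases le_or_gt (ω : ℝ) x with h | h
    · have : Set.Ici (ω : ℝ) ∩ Set.Ioc (x : ℝ) 1 = Set.Ioc (x : ℝ) 1 := by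
        ext z; simp only [Set.mem_inter_iff, Set.mem_Ici, Set.mem_Ioc]; grind
      rw [this, Real.volume_real_Ioc_of_le x.2.2, max_eq_right h]
    · have : Set.Ici (ω : ℝ) ∩ Set.Ioc (x : ℝ) 1 = Set.Icc (ω : ℝ) 1 := by
        ext z; simp only [Set.mem_inter_iff, Set.mem_Ici, Set.mem_Ioc, Set.mem_Icc]; grind
      rw [this, Real.volume_real_Icc_of_le ω.2.2, max_eq_left h.le]
  rw [intervalIntegral.integral_of_le x.2.2]
  simp only [hcdf]
  rw [integral_integral_swap]
  · simp only [hinner]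
    rw [integral_sub (integrable_const _) (integrable_of_continuous _ (by fun_prop))]
    simp
  · refine Integrable.of_bound hm.aestronglyMeasurable 1 (Filter.Eventually.of_forall fun p => ?_)
    simp only [Function.uncurry]
    split_ifs <;> simp

theorem isMPC_iff {F H : Measure State} [IsProbabilityMeasure F] [IsProbabilityMeasure H] :
    IsMPC F H ↔ (∀ x : State, ∫ ω : State, max (ω : ℝ) x ∂H ≤ ∫ ω : State, max (ω : ℝ) x ∂F) ∧
      ∫ ω : State, (ω : ℝ) ∂H = ∫ ω : State, (ω : ℝ) ∂F := by
  have h0 (P : Measure State) [IsProbabilityMeasure P] :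
      ∫ z in (0 : ℝ)..1, cdfState P z = 1 - ∫ ω : State, (ω : ℝ) ∂P := by
    have := integral_cdfState P 0
    simpa [max_eq_left (unitInterval.nonneg _)] using this
  simp only [IsMPC, integral_cdfState, h0, ge_iff_le, sub_le_sub_iff_left, sub_right_inj]

variable {F : Measure State} [IsProbabilityMeasure F]

theorem Signal.integral_posterior (μ : Signal.{u}) {φ : State → ℝ} (hφ : Continuous φ) :
    ∫ s, ∫ ω, φ ω ∂(μ.posterior F s) ∂(μ.messageLaw F) = ∫ ω, φ ω ∂F := by
  have h : (μ.messageLaw F).bind (μ.posterior F) = F := posterior_comp_self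
  have h' := integral_bind_kernel (P := μ.messageLaw F) (κ := μ.posterior F) (φ := φ)
    (by rw [h]; exact integrable_of_continuous F hφ)
  rw [← h', h]

theorem Signal.integrable_integral_posterior (μ : Signal.{u}) {φ : State → ℝ}
    (hφ : Continuous φ) :
    Integrable (fun s => ∫ ω, φ ω ∂(μ.posterior F s)) (μ.messageLaw F) := by
  obtain ⟨C, hC⟩ := isCompact_univ.exists_bound_of_continuousOn hφ.continuousOn
  refine Integrable.of_bound
    (hφ.stronglyMeasurable.integral_kernel (κ := μ.posterior F)).aestronglyMeasurable C
    (Filter.Eventually.of_forall fun s => ?_)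
  simpa using norm_integral_le_of_norm_le_const (μ := μ.posterior F s)
    (Filter.Eventually.of_forall fun ω => hC ω trivial)

/-- The distribution of the posterior mean is a mean-preserving contraction of the prior. -/
theorem Signal.isMPC_meanLaw (μ : Signal.{u}) : IsMPC F (μ.meanLaw F : Measure State) := by
  rw [isMPC_iff]
  constructor
  · intro x
    have hc : Continuous fun ω : State => max (ω : ℝ) x := by fun_prop
    rw [μ.integral_meanLaw hc.measurable, ← μ.integral_posterior hc]
    refine integral_mono ((integrable_of_continuous _ hc).comp_measurable
      (μ.measurable_posteriorMean F)) (μ.integrable_integral_posterior hc) fun s => ?_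
    -- Jensen for a maximum of two affine functions: each of them has its expectation below that of
    -- the maximum.
    refine max_le ?_ ?_
    · exact integral_mono (integrable_coe _) (integrable_of_continuous _ hc)
        fun ω => le_max_left _ _
    · calc (x : ℝ) = ∫ _, (x : ℝ) ∂(μ.posterior F s) := by simp
        _ ≤ _ := integral_mono (integrable_const _) (integrable_of_continuous _ hc)
          fun ω => le_max_right _ _
  · rw [μ.integral_meanLaw measurable_subtype_coe, ← μ.integral_posterior continuous_subtype_val]
    rfl

end MeanPreservingContraction

/-! ### From CDF inequalities to the concave order -/

section ConcaveOrder

/-- Use `min ω t + max ω t = ω + t` and equality of means. -/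
theorem integral_min_le {F H : Measure State} [IsProbabilityMeasure F] [IsProbabilityMeasure H]
    (h : IsMPC F H) (t : ℝ) (ht0 : 0 ≤ t) (ht1 : t ≤ 1) :
    ∫ ω : State, min (ω : ℝ) t ∂F ≤ ∫ ω : State, min (ω : ℝ) t ∂H := by
  obtain ⟨h1, h2⟩ := isMPC_iff.1 h
  have key (P : Measure State) [IsProbabilityMeasure P] : ∫ ω : State, min (ω : ℝ) t ∂P =
      (∫ ω : State, (ω : ℝ) ∂P) + t - ∫ ω : State, max (ω : ℝ) t ∂P := by
    have e : ∀ ω : State, min (ω : ℝ) t = ((ω : ℝ) + t) - max (ω : ℝ) t := fun ω => by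
      linarith [min_add_max (ω : ℝ) t]
    simp only [e]
    rw [integral_sub (f := fun ω : State => (ω : ℝ) + t)
      ((integrable_coe P).add (integrable_const _)) (integrable_of_continuous _ (by fun_prop)),
      integral_add (integrable_coe P) (integrable_const _)]
    simp
  rw [key F, key H, h2]
  linarith [h1 ⟨t, ht0, ht1⟩]

/-- Summation by parts for an antitone sequence of slopes. -/
theorem sum_mul_sub_nonneg {s D : ℕ → ℝ} (hs : ∀ k, s (k + 1) ≤ s k) {N : ℕ}
    (hD : ∀ k ≤ N, 0 ≤ D k) (h0 : D 0 = 0) (hN : D N = 0) :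
    0 ≤ ∑ k ∈ Finset.range N, s k * (D (k + 1) - D k) := by
  -- The boundary term `s m * D (m + 1)` carries the induction and vanishes at the end because `D N
  -- = 0`.
  have key : ∀ m < N, s m * D (m + 1) ≤ ∑ k ∈ Finset.range (m + 1), s k * (D (k + 1) - D k) := by
    intro m
    induction m with
    | zero => intro _; simp [h0]
    | succ m ih =>
      intro hm
      rw [Finset.sum_range_succ]
      nlinarith [ih (by omega), mul_nonneg (sub_nonneg.2 (hs m)) (hD (m + 1) (by omega))]
  cases N with
  | zero => simp
  | succ N => simpa [hN] using key N (by omega)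

/-- The piecewise linear interpolation of `c` at the points `k / N`. -/
def interp (c : ℝ → ℝ) (N m : ℕ) (y : ℝ) : ℝ :=
  c 0 + ∑ k ∈ Finset.range m, N * (c ((k + 1 : ℕ) / N) - c (k / N)) *
    (min y ((k + 1 : ℕ) / N) - min y (k / N))

/-- Beyond the node `m / N` the partial interpolation is frozen at `c (m / N)`, so the next summand
starts from the right value. Within a cell, the interpolant and `c` each move at most `K / N` from
the left node. -/
theorem interp_spec {c : ℝ → ℝ} {K : NNReal} (hc : LipschitzWith K c) {N : ℕ} (hN : 0 < N)
    (m : ℕ) {y : ℝ} (hy : 0 ≤ y) :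
    ((m / N : ℝ) ≤ y → interp c N m y = c (m / N)) ∧
      (y ≤ m / N → |interp c N m y - c y| ≤ 2 * K / N) := by
  have hN' : (0 : ℝ) < N := by exact_mod_cast hN
  induction m with
  | zero =>
    refine ⟨fun _ => by simp [interp], fun h => ?_⟩
    have : y = 0 := le_antisymm (by simpa using h) hy
    simp only [interp, this, Finset.range_zero, Finset.sum_empty, add_zero, sub_self, abs_zero]
    positivity
  | succ m ih =>
    have hstep : interp c N (m + 1) y = interp c N m y +
        N * (c ((m + 1 : ℕ) / N) - c (m / N)) * (min y ((m + 1 : ℕ) / N) - min y (m / N)) := by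
      rw [interp, interp, Finset.sum_range_succ, add_assoc]
    have hlen : ((m + 1 : ℕ) / N : ℝ) - m / N = 1 / N := by
      push_cast; ring
    have hle : (m / N : ℝ) ≤ (m + 1 : ℕ) / N := by
      have : (0 : ℝ) < 1 / N := by positivity
      linarith
    constructor
    · intro h
      rw [hstep, ih.1 (hle.trans h), min_eq_right h, min_eq_right (hle.trans h), hlen]
      field_simp
      ring
    · intro h
      rcases le_total y (m / N) with h' | h'
      · rw [hstep, min_eq_left h, min_eq_left h', sub_self, mul_zero, add_zero]
        exact ih.2 h'
      · rw [hstep, ih.1 h', min_eq_left h, min_eq_right h']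
        have l1 := hc.dist_le_mul ((m + 1 : ℕ) / N : ℝ) (m / N)
        have l2 := hc.dist_le_mul (m / N : ℝ) y
        rw [Real.dist_eq, Real.dist_eq, hlen, abs_of_pos (by positivity : (0 : ℝ) < 1 / N)] at l1
        rw [Real.dist_eq, Real.dist_eq, abs_of_nonpos (by linarith : (m / N : ℝ) - y ≤ 0)] at l2
        have hd : N * (y - m / N) ≤ 1 := by
          have : N * (y - m / N) ≤ N * (1 / N : ℝ) :=
            mul_le_mul_of_nonneg_left (by linarith) hN'.le
          rwa [mul_one_div_cancel hN'.ne'] at this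
        have hd0 : 0 ≤ N * (y - m / N) := mul_nonneg hN'.le (by linarith)
        set δ := c ((m + 1 : ℕ) / N) - c (m / N)
        have l3 : |N * δ * (y - m / N)| ≤ K * (1 / N) := by
          have e : N * δ * (y - m / N) = (N * (y - m / N)) * δ := by ring
          rw [e, abs_mul, abs_of_nonneg hd0]
          exact (mul_le_of_le_one_left (abs_nonneg _) hd).trans l1
        have l4 : |c (m / N) - c y| ≤ K * (1 / N) :=
          l2.trans (mul_le_mul_of_nonneg_left (by linarith) K.2)
        have e : c (m / N) + N * δ * (y - m / N) - c y =
          N * δ * (y - m / N) + (c (m / N) - c y) := by ring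
        rw [e]
        refine (abs_add_le _ _).trans ?_
        have : 2 * (K : ℝ) / N = K * (1 / N) + K * (1 / N) := by ring
        linarith

theorem integral_interp (P : Measure State) [IsProbabilityMeasure P] (c : ℝ → ℝ) (N m : ℕ) :
    ∫ ω : State, interp c N m ω ∂P = c 0 + ∑ k ∈ Finset.range m,
      N * (c ((k + 1 : ℕ) / N) - c (k / N)) *
        (∫ ω : State, min (ω : ℝ) ((k + 1 : ℕ) / N) ∂P - ∫ ω : State, min (ω : ℝ) (k / N) ∂P) := by
  have hi (t : ℝ) : Integrable (fun ω : State => min (ω : ℝ) t) P :=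
    integrable_of_continuous P (by fun_prop)
  have hs (k : ℕ) : Integrable (fun ω : State => N * (c ((k + 1 : ℕ) / N) - c (k / N)) *
      (min (ω : ℝ) ((k + 1 : ℕ) / N) - min (ω : ℝ) (k / N))) P :=
    ((hi _).sub (hi _)).const_mul _
  simp only [interp]
  rw [integral_add (integrable_const _) (integrable_finsetSum _ fun k _ => hs k),
    integral_finsetSum _ fun k _ => hs k]
  simp only [integral_const_mul]
  congr 1
  · simp
  · exact Finset.sum_congr rfl fun k _ => by rw [integral_sub (hi _) (hi _)]

/-- A mean-preserving contraction dominates in the concave order. -/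
theorem IsMPC.integral_concave_le {F H : Measure State} [IsProbabilityMeasure F]
    [IsProbabilityMeasure H] (h : IsMPC F H) {c : ℝ → ℝ} {K : NNReal} (hc : LipschitzWith K c)
    (hconc : ConcaveOn ℝ Set.univ c) :
    ∫ ω : State, c ω ∂F ≤ ∫ ω : State, c ω ∂H := by
  have hcont (P : Measure State) [IsProbabilityMeasure P] :
      Integrable (fun ω : State => c ω) P :=
    integrable_of_continuous P (hc.continuous.comp continuous_subtype_val)
  have hint (P : Measure State) [IsProbabilityMeasure P] (N : ℕ) :
      Integrable (fun ω : State => interp c N N ω) P :=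
    integrable_of_continuous P (by unfold interp; fun_prop)
  have hmean := (isMPC_iff.1 h).2
  have happrox (P : Measure State) [IsProbabilityMeasure P] {N : ℕ} (hN : 0 < N) :
      |∫ ω : State, interp c N N ω ∂P - ∫ ω : State, c ω ∂P| ≤ 2 * K / N := by
    rw [← integral_sub (hint P N) (hcont P)]
    simpa using norm_integral_le_of_norm_le_const (μ := P) (C := 2 * K / N)
      (f := fun ω : State => interp c N N ω - c ω) (Filter.Eventually.of_forall fun ω : State => (interp_spec hc hN N ω.2.1).2
        (by rw [div_self (Nat.cast_ne_zero.2 hN.ne')]; exact ω.2.2))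
  have hinterp {N : ℕ} (hN : 0 < N) :
      ∫ ω : State, interp c N N ω ∂F ≤ ∫ ω : State, interp c N N ω ∂H := by
    have hN' : (0 : ℝ) < N := by exact_mod_cast hN
    set D : ℕ → ℝ := fun k => ∫ ω : State, min (ω : ℝ) (k / N) ∂H -
      ∫ ω : State, min (ω : ℝ) (k / N) ∂F with hD
    have := sum_mul_sub_nonneg (s := fun k : ℕ => N * (c ((k + 1 : ℕ) / N) - c (k / N)))
      (D := D) (N := N) (fun k => ?_) (fun k hk => ?_) ?_ ?_
    · rw [integral_interp, integral_interp, ← sub_nonneg, add_sub_add_left_eq_sub,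
        ← Finset.sum_sub_distrib]
      refine this.trans_eq (Finset.sum_congr rfl fun k _ => ?_)
      simp only [hD]
      ring
    · refine mul_le_mul_of_nonneg_left ?_ hN'.le
      -- Midpoint concavity on `k / N` and `(k + 2) / N` makes the slopes antitone.
      have := hconc.2 (Set.mem_univ ((k : ℝ) / N)) (Set.mem_univ ((k + 1 + 1 : ℕ) / N : ℝ))
        (by norm_num : (0 : ℝ) ≤ 1 / 2) (by norm_num : (0 : ℝ) ≤ 1 / 2) (by norm_num)
      have e : (1 / 2 : ℝ) • ((k : ℝ) / N) + (1 / 2 : ℝ) • ((k + 1 + 1 : ℕ) / N : ℝ) =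
          (k + 1 : ℕ) / N := by
        simp only [smul_eq_mul]; push_cast; ring
      rw [e] at this
      simp only [smul_eq_mul] at this
      linarith
    · rw [hD]
      exact sub_nonneg.2 (integral_min_le h _ (by positivity)
        (div_le_one_of_le₀ (by exact_mod_cast hk) hN'.le))
    · have e : ∀ ω : State, min (ω : ℝ) 0 = 0 := fun ω => min_eq_right ω.2.1
      simp [hD, e]
    · have e : ∀ ω : State, min (ω : ℝ) 1 = ω := fun ω => min_eq_left ω.2.2
      simp [hD, div_self hN'.ne', e, hmean]
  refine le_of_forall_pos_le_add fun ε hε => ?_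
  -- Two approximation errors, one for `F` and one for `H`, each at most `2 * K / N`.
  obtain ⟨N, hN⟩ := exists_nat_gt (4 * K / ε)
  have hN' : (0 : ℝ) < N := lt_of_le_of_lt (by positivity) hN
  have hN0 : 0 < N := by exact_mod_cast hN'
  have hb : 2 * K / N + 2 * K / N ≤ ε := by
    rw [div_lt_iff₀ hε] at hN
    rw [← add_div, div_le_iff₀ hN']
    linarith
  have a1 := abs_le.1 (happrox F hN0)
  have a2 := abs_le.1 (happrox H hN0)
  linarith [hinterp hN0]

end ConcaveOrder

/-! ### Martingale couplings by duality -/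

section Coupling

/-- M. Riesz extension for a functional that is given on the parameter space of a subspace. -/
theorem exists_nonneg_extension {P E : Type*} [AddCommGroup P] [Module ℝ P] [AddCommGroup E]
    [Module ℝ E] (T : P →ₗ[ℝ] E) (l : P →ₗ[ℝ] ℝ) (s : PointedCone ℝ E)
    (hpos : ∀ p, T p ∈ s → 0 ≤ l p) (hdense : ∀ y, ∃ p, T p + y ∈ s) :
    ∃ L : E →ₗ[ℝ] ℝ, (∀ p, L (T p) = l p) ∧ ∀ x ∈ s, 0 ≤ L x := by
  -- `0` lies in the cone, so positivity at `p` and `-p` kills `l` on the kernel; `l` then descends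
  -- to the range of `T`.
  have hker : LinearMap.ker T ≤ LinearMap.ker l := by
    intro p hp
    rw [LinearMap.mem_ker] at hp ⊢
    have h1 := hpos p (by rw [hp]; exact s.zero_mem)
    have h2 := hpos (-p) (by rw [map_neg, hp, neg_zero]; exact s.zero_mem)
    rw [map_neg] at h2
    linarith
  let f : E →ₗ.[ℝ] ℝ := ⟨LinearMap.range T,
    (LinearMap.ker T).liftQ l hker ∘ₗ T.quotKerEquivRange.symm.toLinearMap⟩
  have hf (p : P) : f ⟨T p, p, rfl⟩ = l p := by
    have : T.quotKerEquivRange.symm ⟨T p, p, rfl⟩ = (LinearMap.ker T).mkQ p := by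
      rw [LinearEquiv.symm_apply_eq]
      rfl
    change (LinearMap.ker T).liftQ l hker (T.quotKerEquivRange.symm ⟨T p, p, rfl⟩) = l p
    rw [this]
    rfl
  obtain ⟨L, hL, hLs⟩ := riesz_extension s f
    (by rintro ⟨_, p, rfl⟩ hp
        rw [hf]
        exact hpos p hp)
    (fun y => by
      obtain ⟨p, hp⟩ := hdense y
      exact ⟨⟨T p, p, rfl⟩, hp⟩)
  exact ⟨L, fun p => (hL ⟨T p, p, rfl⟩).trans (hf p), hLs⟩

/-- Riesz–Markov–Kakutani; on a compact space every continuous function has compact support. -/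
theorem exists_measure_of_nonneg {X : Type*} [TopologicalSpace X] [CompactSpace X] [T2Space X]
    [MeasurableSpace X] [BorelSpace X] (L : C(X, ℝ) →ₗ[ℝ] ℝ) (hL : ∀ φ, 0 ≤ φ → 0 ≤ L φ) :
    ∃ π : Measure X, IsFiniteMeasure π ∧ ∀ φ : C(X, ℝ), ∫ x, φ x ∂π = L φ := by
  let Λ : CompactlySupportedContinuousMap X ℝ →ₚ[ℝ] ℝ := PositiveLinearMap.mk₀
    { toFun := fun φ => L φ.toContinuousMap
      map_add' := fun φ ψ => L.map_add φ.toContinuousMap ψ.toContinuousMap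
      map_smul' := fun r φ => L.map_smul r φ.toContinuousMap }
    (fun φ hφ => hL _ hφ)
  exact ⟨RealRMK.rieszMeasure Λ, inferInstance, fun φ => RealRMK.integral_rieszMeasure Λ
    (CompactlySupportedContinuousMap.continuousMapEquiv φ)⟩

/-- The functions `(ω, m) ↦ φ ω + χ m + h m * (ω - m)`, whose integrals are pinned down by the
marginals and the martingale property of a coupling. -/
def martingaleTest : C(State, ℝ) × C(State, ℝ) × C(State, ℝ) →ₗ[ℝ] C(State × State, ℝ) where
  toFun p := ⟨fun x => p.1 x.1 + p.2.1 x.2 + p.2.2 x.2 * ((x.1 : ℝ) - x.2), by fun_prop⟩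
  map_add' p q := by ext x; simp; ring
  map_smul' r p := by ext x; simp; ring

theorem ContinuousMap.integrable_state (P : Measure State) [IsFiniteMeasure P] (φ : C(State, ℝ)) :
    Integrable φ P :=
  integrable_of_continuous P φ.continuous

/-- Integration against `P` as a linear functional on continuous functions. -/
def integralFunctional (P : Measure State) [IsFiniteMeasure P] : C(State, ℝ) →ₗ[ℝ] ℝ where
  toFun φ := ∫ ω, φ ω ∂P
  map_add' φ ψ := integral_add (ContinuousMap.integrable_state P φ)
    (ContinuousMap.integrable_state P ψ)
  map_smul' r φ := integral_const_mul r φ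

variable {F H : Measure State} [IsProbabilityMeasure F] [IsProbabilityMeasure H]

/-- This is the positivity that the extension needs. The infimum `c` over `m` of the affine
functions `χ m + h m * (y - m)` is concave and Lipschitz, lies below `χ` (take `m = y`) and, by
`hpos`, above `-φ`. The concave order gives `∫ -φ ∂F ≤ ∫ c ∂F ≤ ∫ c ∂H ≤ ∫ χ ∂H`. -/
theorem IsMPC.martingaleTest_nonneg (hFH : IsMPC F H) (φ χ h : C(State, ℝ))
    (hpos : ∀ ω m : State, 0 ≤ φ ω + χ m + h m * ((ω : ℝ) - m)) :
    0 ≤ ∫ ω, φ ω ∂F + ∫ m, χ m ∂H := by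
  obtain ⟨K, hK⟩ := isCompact_univ.exists_bound_of_continuousOn h.continuous.continuousOn
  replace hK : ∀ m, |h m| ≤ K := fun m => hK m trivial
  have hK0 : 0 ≤ K := (abs_nonneg _).trans (hK 0)
  let c : ℝ → ℝ := fun y => ⨅ m : State, χ m + h m * (y - m)
  have hbdd (y : ℝ) : BddBelow (Set.range fun m : State => χ m + h m * (y - m)) := by
    have hc : Continuous fun m : State => χ m + h m * (y - m) := by fun_prop
    exact (isCompact_range hc).bddBelow
  have hcle (y : ℝ) (m : State) : c y ≤ χ m + h m * (y - m) := ciInf_le (hbdd y) m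
  have hlip : LipschitzWith K.toNNReal c := by
    refine LipschitzWith.of_le_add_mul _ fun y z => ?_
    rw [Real.coe_toNNReal _ hK0, ← sub_le_iff_le_add]
    refine le_ciInf fun m => ?_
    have h1 : h m * (y - z) ≤ K * dist y z := by
      rw [Real.dist_eq]
      refine (le_abs_self _).trans ?_
      rw [abs_mul]
      exact mul_le_mul_of_nonneg_right (hK m) (abs_nonneg _)
    linarith [hcle y m]
  have hconc : ConcaveOn ℝ Set.univ c := by
    refine ⟨convex_univ, fun y _ z _ a b ha hb hab => le_ciInf fun m => ?_⟩
    have e : χ m + h m * ((a • y + b • z) - m) =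
        a * (χ m + h m * (y - m)) + b * (χ m + h m * (z - m)) := by
      obtain rfl : b = 1 - a := by linarith
      simp only [smul_eq_mul]
      ring
    rw [e]
    exact add_le_add (mul_le_mul_of_nonneg_left (hcle y m) ha)
      (mul_le_mul_of_nonneg_left (hcle z m) hb)
  have hc (P : Measure State) [IsProbabilityMeasure P] : Integrable (fun ω : State => c ω) P :=
    integrable_of_continuous P (hlip.continuous.comp continuous_subtype_val)
  have h1 : ∫ m : State, c m ∂H ≤ ∫ m, χ m ∂H :=
    integral_mono (hc H) (ContinuousMap.integrable_state H χ) fun m => by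
      simpa using hcle m m
  have h2 : ∫ ω : State, -φ ω ∂F ≤ ∫ ω : State, c ω ∂F :=
    integral_mono (ContinuousMap.integrable_state F φ).neg (hc F) fun ω =>
      le_ciInf fun m => by linarith [hpos ω m]
  rw [integral_neg] at h2
  linarith [hFH.integral_concave_le hlip hconc]

/-- **Strassen's theorem** on `[0, 1]`: a mean-preserving contraction `H` of `F` is the second
marginal of a martingale coupling. -/
theorem IsMPC.exists_martingale_coupling (hFH : IsMPC F H) :
    ∃ π : Measure (State × State), IsProbabilityMeasure π ∧ π.fst = F ∧ π.snd = H ∧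
      ∀ h : C(State, ℝ), ∫ p, h p.2 * ((p.1 : ℝ) - p.2) ∂π = 0 := by
  let s : PointedCone ℝ C(State × State, ℝ) := PointedCone.positive ℝ C(State × State, ℝ)
  have hs (φ : C(State × State, ℝ)) : φ ∈ s ↔ ∀ p, 0 ≤ φ p := Iff.rfl
  obtain ⟨L, hL, hLs⟩ := exists_nonneg_extension martingaleTest
    ((integralFunctional F).coprod ((integralFunctional H).coprod 0)) s
    (by
      rintro ⟨φ, χ, h⟩ hp
      have := hFH.martingaleTest_nonneg φ χ h fun ω m => (hs _).1 hp (ω, m)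
      simpa [integralFunctional] using this)
    (by
      intro ψ
      -- Constants are test functions, and `‖ψ‖ + ψ` is nonnegative.
      refine ⟨(ContinuousMap.const _ ‖ψ‖, 0, 0), (hs _).2 fun p => ?_⟩
      have := neg_le_of_abs_le (ψ.norm_coe_le_norm p)
      simp [martingaleTest]
      linarith)
  obtain ⟨π, _, hπ⟩ := exists_measure_of_nonneg L fun φ hφ => hLs φ hφ
  have key (φ χ h : C(State, ℝ)) :
      ∫ p, (φ p.1 + χ p.2 + h p.2 * ((p.1 : ℝ) - p.2)) ∂π = ∫ ω, φ ω ∂F + ∫ m, χ m ∂H := by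
    have := (hπ (martingaleTest (φ, χ, h))).trans (hL (φ, χ, h))
    simpa [integralFunctional, martingaleTest] using this
  have hfst : π.fst = F := by
    refine ext_of_forall_integral_eq_of_IsFiniteMeasure fun φ => ?_
    rw [Measure.fst, integral_map measurable_fst.aemeasurable
      φ.continuous.aestronglyMeasurable]
    simpa using key φ.toContinuousMap 0 0
  have hsnd : π.snd = H := by
    refine ext_of_forall_integral_eq_of_IsFiniteMeasure fun φ => ?_
    rw [Measure.snd, integral_map measurable_snd.aemeasurable
      φ.continuous.aestronglyMeasurable]
    simpa using key 0 φ.toContinuousMap 0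
  refine ⟨π, ⟨?_⟩, hfst, hsnd, fun h => by simpa using key 0 0 h⟩
  rw [← Measure.fst_univ, hfst, measure_univ]

end Coupling

/-! ### Realizing a contraction by a signal -/

section Realization

variable {F H : Measure State} [IsProbabilityMeasure F] [IsProbabilityMeasure H]

/-- Continuous functions separate finite measures, so the measures with densities `a` and `b` agree.
Values in `[0, 1]` ensure finiteness and that `ENNReal.ofReal` loses nothing. -/
theorem ae_eq_of_forall_integral_mul_eq {a b : State → ℝ} (ha : Measurable a) (hb : Measurable b)
    (ha' : ∀ m, a m ∈ Set.Icc 0 1) (hb' : ∀ m, b m ∈ Set.Icc 0 1)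
    (h : ∀ φ : C(State, ℝ), ∫ m, φ m * a m ∂H = ∫ m, φ m * b m ∂H) : a =ᵐ[H] b := by
  have hint {a : State → ℝ} (ha : Measurable a) (ha' : ∀ m, a m ∈ Set.Icc 0 1)
      (φ : BoundedContinuousFunction State ℝ) :
      ∫ m, φ m ∂(H.withDensity fun m => ENNReal.ofReal (a m)) = ∫ m, φ m * a m ∂H := by
    rw [integral_withDensity_eq_integral_toReal_smul (by fun_prop) (by simp)]
    refine integral_congr_ae (Filter.Eventually.of_forall fun m => ?_)
    simp [ENNReal.toReal_ofReal (ha' m).1, mul_comm]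
  have hfin {a : State → ℝ} (ha' : ∀ m, a m ∈ Set.Icc 0 1) :
      ∫⁻ m, ENNReal.ofReal (a m) ∂H ≠ ⊤ := by
    refine ne_top_of_le_ne_top ENNReal.one_ne_top ?_
    calc ∫⁻ m, ENNReal.ofReal (a m) ∂H ≤ ∫⁻ _, 1 ∂H :=
          lintegral_mono fun m => ENNReal.ofReal_le_one.2 (ha' m).2
      _ = 1 := by simp
  have := isFiniteMeasure_withDensity (hfin ha')
  have := isFiniteMeasure_withDensity (hfin hb')
  have heq : (H.withDensity fun m => ENNReal.ofReal (a m)) =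
      H.withDensity fun m => ENNReal.ofReal (b m) :=
    ext_of_forall_integral_eq_of_IsFiniteMeasure fun φ => by
      rw [hint ha ha', hint hb hb']
      exact h φ.toContinuousMap
  rw [withDensity_eq_iff (by fun_prop) (by fun_prop) (hfin ha')] at heq
  filter_upwards [heq] with m hm
  exact (ENNReal.ofReal_eq_ofReal_iff (ha' m).1 (hb' m).1).1 hm

theorem Signal.integral_mul_posteriorMean (μ : Signal.{u}) {ψ : μ.S → ℝ}
    (hψ : Integrable (fun p : μ.S × State => ψ p.1 * (p.2 : ℝ))
      ((μ.messageLaw F) ⊗ₘ (μ.posterior F))) :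
    ∫ p, ψ p.1 * (p.2 : ℝ) ∂((μ.messageLaw F) ⊗ₘ (μ.posterior F)) =
      ∫ s, ψ s * (μ.posteriorMean F s : ℝ) ∂(μ.messageLaw F) := by
  rw [Measure.integral_compProd hψ]
  simp only [integral_const_mul]
  rfl

/-- Every mean-preserving contraction of the prior is the distribution of the posterior mean of
some signal. -/
theorem IsMPC.exists_signal {H : ProbabilityMeasure State} (hFH : IsMPC F (H : Measure State)) :
    ∃ μ : Signal.{u}, μ.meanLaw F = H := by
  obtain ⟨π, _, hfst, hsnd, hmart⟩ := hFH.exists_martingale_coupling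
  -- Lifting puts the message space, a copy of `State`, in the universe required of signals.
  have hup : Measurable (ULift.up : State → ULift.{u} State) := measurable_up
  have hdis : F ⊗ₘ π.condKernel = π := by
    conv_rhs => rw [← π.disintegrate π.condKernel, hfst]
  have hker : IsMarkovKernel (π.condKernel.map (ULift.up : State → ULift.{u} State)) :=
    Kernel.IsMarkovKernel.map _ hup
  let μ : Signal.{u} := ⟨ULift.{u} State, π.condKernel.map ULift.up⟩
  have hjoint : F ⊗ₘ μ.kernel = π.map (Prod.map id ULift.up) := by
    change F ⊗ₘ (π.condKernel.map (ULift.up : State → ULift.{u} State)) = _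
    rw [Measure.compProd_map hup, hdis]
  have hlaw : μ.messageLaw F = (H : Measure State).map ULift.up := by
    have : μ.messageLaw F = (F ⊗ₘ μ.kernel).snd := (Measure.snd_compProd _ _).symm
    rw [this, hjoint, ← hsnd, Measure.snd, Measure.snd, Measure.map_map measurable_snd
      (measurable_id.prodMap hup), Measure.map_map hup measurable_snd]
    rfl
  have hpost : (μ.messageLaw F) ⊗ₘ (μ.posterior F) =
      π.map fun p => ((⟨p.2⟩ : ULift.{u} State), p.1) := by
    have : (μ.messageLaw F) ⊗ₘ (μ.posterior F) = (F ⊗ₘ μ.kernel).map Prod.swap :=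
      compProd_posterior_eq_map_swap
    rw [this, hjoint, Measure.map_map measurable_swap (measurable_id.prodMap hup)]
    rfl
  -- A message is almost surely its own posterior mean: tested against continuous `φ`, this is the
  -- martingale identity of the coupling.
  have hae : (fun m => (μ.posteriorMean F ⟨m⟩ : ℝ)) =ᵐ[(H : Measure State)]
      fun m => (m : ℝ) := by
    refine ae_eq_of_forall_integral_mul_eq
      (measurable_subtype_coe.comp ((μ.measurable_posteriorMean F).comp hup))
      measurable_subtype_coe (fun m => (μ.posteriorMean F _).2) (fun m => m.2) fun φ => ?_
    have hint {f : State × State → ℝ} (hf : Continuous f) : Integrable f π :=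
      hf.integrable_of_hasCompactSupport (HasCompactSupport.of_compactSpace f)
    have hmeas : Measurable fun p : State × State => ((⟨p.2⟩ : ULift.{u} State), p.1) :=
      (hup.comp measurable_snd).prodMk measurable_fst
    have hψ : Measurable fun p : ULift.{u} State × State => φ p.1.down * (p.2 : ℝ) :=
      (φ.continuous.measurable.comp (measurable_down.comp measurable_fst)).mul
        (measurable_subtype_coe.comp measurable_snd)
    have e1 : ∫ p, φ p.2 * (p.1 : ℝ) ∂π =
        ∫ m, φ m * (μ.posteriorMean F ⟨m⟩ : ℝ) ∂(H : Measure State) := by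
      have l1 : ∫ p, φ p.1.down * (p.2 : ℝ) ∂((μ.messageLaw F) ⊗ₘ (μ.posterior F)) =
          ∫ p, φ p.2 * (p.1 : ℝ) ∂π := by
        rw [hpost]
        exact integral_map hmeas.aemeasurable hψ.aestronglyMeasurable
      have l2 : Integrable (fun p : ULift.{u} State × State => φ p.1.down * (p.2 : ℝ))
          ((μ.messageLaw F) ⊗ₘ (μ.posterior F)) := by
        rw [hpost]
        exact (integrable_map_measure hψ.aestronglyMeasurable hmeas.aemeasurable).2
          (hint (f := fun p => φ p.2 * (p.1 : ℝ)) (by fun_prop))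
      rw [← l1]
      refine (μ.integral_mul_posteriorMean (ψ := fun s => φ (ULift.down s)) l2).trans ?_
      rw [hlaw]
      exact integral_map hup.aemeasurable
        ((φ.continuous.measurable.comp measurable_down).mul
          (measurable_subtype_coe.comp (μ.measurable_posteriorMean F))).aestronglyMeasurable
    have e2 : ∫ p, φ p.2 * (p.2 : ℝ) ∂π = ∫ m, φ m * (m : ℝ) ∂(H : Measure State) := by
      rw [← hsnd, Measure.snd, integral_map measurable_snd.aemeasurable
        (Continuous.aestronglyMeasurable (by fun_prop))]
    have e3 := hmart φ
    simp only [mul_sub] at e3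
    rw [integral_sub (hint (by fun_prop)) (hint (by fun_prop)), e1, e2] at e3
    exact sub_eq_zero.1 e3
  refine ⟨μ, Subtype.ext ?_⟩
  change (μ.messageLaw F).map (μ.posteriorMean F) = (H : Measure State)
  rw [hlaw, Measure.map_map (μ.measurable_posteriorMean F) hup]
  conv_rhs => rw [← Measure.map_id (μ := (H : Measure State))]
  exact Measure.map_congr (hae.mono fun m hm => Subtype.ext hm)

end Realization

/-! ### Equivalence with the program -/

theorem solvesProgram_iff {F : Measure State} [IsProbabilityMeasure F] {A : Type w}
    [TopologicalSpace A] [CompactSpace A] [Nonempty A] {n : ℕ} {u v : A → State → Fin n → ℝ}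
    {g : Fin n → ℝ} (hg : ∀ θ, 0 < g θ) (hu : QuasiLinear u) (hv : QuasiLinear v)
    (μ : Fin n → Signal.{u}) :
    (IncentiveCompatible F u μ ∧ DesignerOptimal F g u v μ) ↔
      SolvesProgram F g u v (fun θ => (μ θ).meanLaw F) := by
  constructor
  · rintro ⟨hic, a, hopt, hpay, hmax⟩
    refine ⟨⟨hic, fun θ => (μ θ).isMPC_meanLaw⟩, fun H hH => ?_⟩
    -- A feasible `H` is realized by an incentive compatible direct mechanism, which competes with
    -- `μ` as a menu.
    choose ν hν using fun θ => (hH.mpc θ).exists_signal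
    have hνic : IncentiveCompatible F u ν := by
      intro θ θ'
      rw [hν, hν]
      exact hH.ic θ θ'
    obtain ⟨b, hbopt, hbpay, hb⟩ := hνic.exists_action (g := g) hu hv
    calc programObjective g u v H = (Strategy.mk ν b).designerPayoff F g v := by
          rw [hb]; simp only [hν]
      _ ≤ (Strategy.mk μ a).designerPayoff F g v := hmax _ _ hbopt hbpay
      _ ≤ _ := Strategy.designerPayoff_le hg hu hv hopt hpay
  · rintro ⟨hfeas, hmax⟩
    refine ⟨hfeas.ic, ?_⟩
    obtain ⟨a, hopt, hpay, ha⟩ :=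
      IncentiveCompatible.exists_action (F := F) (μ := μ) (g := g) hu hv hfeas.ic
    refine ⟨a, hopt, hpay, fun M σ hσ hσpay => ?_⟩
    rw [ha]
    exact (Strategy.designerPayoff_le hg hu hv hσ hσpay).trans
      (hmax _ ⟨hσ.programFeasible_ic hu, fun θ => (σ.signal θ).isMPC_meanLaw⟩)

end InfoDesign

end

theorem proposition1 {A : Type w} [TopologicalSpace A] [CompactSpace A] [Nonempty A] {n : ℕ}
    (f : InfoDesign.State → ENNReal) (hf : Measurable f)
    (F : MeasureTheory.Measure InfoDesign.State) [MeasureTheory.IsProbabilityMeasure F]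
    (hF : F = MeasureTheory.volume.withDensity f)
    (g : Fin n → ℝ) (hg_pos : ∀ θ, 0 < g θ) (hg_sum : ∑ θ, g θ = 1)
    (u v : A → InfoDesign.State → Fin n → ℝ)
    (hu : InfoDesign.QuasiLinear u) (hv : InfoDesign.QuasiLinear v)
    (μ : Fin n → InfoDesign.Signal.{u}) :
    (InfoDesign.IncentiveCompatible F u μ ∧ InfoDesign.DesignerOptimal F g u v μ) ↔
      InfoDesign.SolvesProgram F g u v (fun θ => (μ θ).meanLaw F) :=
  InfoDesign.solvesProgram_iff hg_pos hu hv μ
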